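/- Let $\mathbb F_q$ be a finite field with $q$ elements, let $\phi:\mathbb F_q\to\{0,1,\dots,q-1\}$ be a bijection with $\phi(0)=0$, let $d\ge 1$ be an integer, and let $q_1,\dots,q_d\in\mathbb F_q[x]$ be monic, non-constant, pairwise coprime polynomials with degrees $e_1,\dots,e_d$. For each $j\in\{1,\dots,d\}$ let $C^{(j)}=(c^{(j)}_{i,k})_{i\ge1,\,k\ge0}$ be one of the following two matrices over $\mathbb F_q$. (a) (Niederreiter's construction) Write $i=e_js-r$ with $s\ge1$ and $0\le r<e_j$. Then $c^{(j)}_{i,k}$ is the coefficient of $x^{-k-1}$ in the expansion of $x^r/q_j(x)^s$ in $\mathbb F_q((x^{-1}))$. (b) (Column by column construction) Write $x^k=\sum_{s\ge0}b_s(x)\,q_j(x)^s$ with $b_s\in\mathbb F_q[x]$ and $\deg b_s<e_j$. Then $c^{(j)}_{e_js+t+1,\,k}$, for $s\ge0$ and $0\le t<e_j$, is the coefficient of $x^t$ in $b_s$. (In particular, all the matrices may come from (a), or all of them from (b).) Let $(\boldsymbol x_n)_{n\ge0}$, $\boldsymbol x_n=(x_n^{(1)},\dots,x_n^{(d)})\in[0,1)^d$,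 be the digital sequence generated by $C^{(1)},\dots,C^{(d)}$: if $n=\sum_{k\ge0}n_kq^k$ with $n_k\in\{0,\dots,q-1\}$, then $$x_n^{(j)}=\sum_{i\ge1}\frac{\phi\big(y_i^{(j)}\big)}{q^i},\qquad y_i^{(j)}=\sum_{k\ge0}c^{(j)}_{i,k}\,\phi^{-1}(n_k).$$ Then $(\boldsymbol x_n)_{n\ge0}$ does not have Poissonian pair correlations. That is, it is not the case that for every real $s\ge0$ $$\lim_{N\to\infty}\frac1N\,\#\Big\{(n,l): 0\le n,l\le N-1,\ n\ne l,\ \|\boldsymbol x_n-\boldsymbol x_l\|_\infty\le \frac{s}{N^{1/d}}\Big\}=(2s)^d ,$$ where $\|\boldsymbol z\|_\infty=\max_{1\le j\le d}\min_{a\in\mathbb Z}|z^{(j)}-a|$. -/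

import Mathlib

open scoped Polynomial

noncomputable section

/-- Maximum over the coordinates of the distance to the nearest integer
(the norm on `Fin d → ℝ` is the maximum norm). -/
def torusSupNorm {d : ℕ} (x : Fin d → ℝ) : ℝ :=
  ‖fun j => x j - (round (x j) : ℝ)‖

/-- Number of ordered pairs `(n, l)` with `0 ≤ n ≠ l ≤ N - 1` such that
`‖x n - x l‖_∞ ≤ s / N ^ (1 / d)`. -/
def pairCount {d : ℕ} (x : ℕ → Fin d → ℝ) (s : ℝ) (N : ℕ) : ℕ :=
  Set.ncard {p : ℕ × ℕ | p.1 < N ∧ p.2 < N ∧ p.1 ≠ p.2 ∧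
    torusSupNorm (x p.1 - x p.2) ≤ s / (N : ℝ) ^ (1 / (d : ℝ))}

/-- Poissonian pair correlations of a `d`-dimensional sequence. -/
def HasPoissonianPairCorrelations {d : ℕ} (x : ℕ → Fin d → ℝ) : Prop :=
  ∀ s : ℝ, 0 ≤ s →
    Filter.Tendsto (fun N : ℕ => (pairCount x s N : ℝ) / (N : ℝ)) Filter.atTop
      (nhds ((2 * s) ^ d))

section Digital

variable {F : Type*} [Field F] [Fintype F]

/-- The `k`-th digit of `n` in base `q = #F`, as an element of `{0, …, q - 1}`. -/
def baseDigit (F : Type*) [Field F] [Fintype F] (n k : ℕ) : Fin (Fintype.card F) :=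
  ⟨n / Fintype.card F ^ k % Fintype.card F, Nat.mod_lt _ Fintype.card_pos⟩

/-- The entries of `C · (φ⁻¹(n₀), φ⁻¹(n₁), …)ᵀ`. Rows are indexed from `0` here, so that row `i`
is the `(i + 1)`-st row. When `φ 0 = 0`, only finitely many summands are nonzero. -/
def digitalVector (φ : F ≃ Fin (Fintype.card F)) (C : Matrix ℕ ℕ F) (n i : ℕ) : F :=
  ∑ᶠ k : ℕ, C i k * φ.symm (baseDigit F n k)

/-- The digital sequence over `F` with digit bijection `φ` and generating matrices `C`. -/
def digitalSequence {d : ℕ} (φ : F ≃ Fin (Fintype.card F)) (C : Fin d → Matrix ℕ ℕ F)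
    (n : ℕ) (j : Fin d) : ℝ :=
  ∑' i : ℕ, ((φ (digitalVector φ (C j) n i) : ℕ) : ℝ) / (Fintype.card F : ℝ) ^ (i + 1)

end Digital

section Matrices

variable {F : Type*} [Field F]

/-- The embedding of `F[x]` into `F((x⁻¹))`. The variable of `LaurentSeries F` plays the role
of `x⁻¹`, so `x` is sent to the monomial of exponent `-1`. -/
def polyAtInfinity : F[X] →ₐ[F] LaurentSeries F :=
  Polynomial.aeval (HahnSeries.single (-1 : ℤ) (1 : F))

/-- The coefficient of `x ^ (-k - 1)` in the expansion of `x ^ r / Q ^ s` in `F((x⁻¹))`. -/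
def laurentDigit (Q : F[X]) (s r k : ℕ) : F :=
  (polyAtInfinity (Polynomial.X ^ r : F[X]) / polyAtInfinity (Q ^ s)).coeff ((k : ℤ) + 1)

/-- The Niederreiter matrix of `Q`. With `e = deg Q`, the row with one-based index `i + 1` is
given by `x ^ r / Q ^ s` with `i + 1 = e * s - r`, `s ≥ 1` and `0 ≤ r < e`. -/
def niederreiterMatrix (Q : F[X]) : Matrix ℕ ℕ F := fun i k =>
  laurentDigit Q (i / Q.natDegree + 1) (Q.natDegree - 1 - i % Q.natDegree) k

/-- The `Q`-adic digit `b_s` of `f`, by repeated division with remainder: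
`f = ∑ b_s * Q ^ s` with `deg b_s < deg Q`. -/
def adicDigit (Q f : F[X]) (s : ℕ) : F[X] :=
  ((fun g : F[X] => g /ₘ Q)^[s] f) %ₘ Q

/-- The column by column matrix of `Q`. With `e = deg Q`, the entry in the row with one-based
index `e * s + t + 1` (`0 ≤ t < e`) and in column `k` is the coefficient of `x ^ t` in the digit
`b_s` of `x ^ k`. -/
def columnMatrix (Q : F[X]) : Matrix ℕ ℕ F := fun i k =>
  (adicDigit Q (Polynomial.X ^ k) (i / Q.natDegree)).coeff (i % Q.natDegree)

end Matrices

end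

/-!
Read the coefficients of a polynomial `P` as a digit vector. For both constructions, row `i` of the
matrix of `Q` depends only on `P` modulo `Q ^ s` when `i < s * deg Q`, multiplying `P` by `Q` moves
the rows down by `deg Q`, and the constant `1` is sent to the first unit vector. A polynomial
`P = ∏ Q_k ^ (S_k)` with all `S_k * deg Q_k` equal to some `A`, and with `∏_{k ≠ j} Q_k ^ (S_k) ≡ 1`
modulo a high power of every `Q_j` (possible because the residue rings are finite), has degree
`d * A` and is sent by each of the `d` matrices to the same unit vector `e_A`, up to an error far
beyond row `A`. Adding `P` to any of the `q ^ (d * A)` or more polynomials `D` of degree below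
`d * (A + 1)` whose images vanish in row `A` translates the corresponding point by almost exactly
`φ(1) / q ^ (A + 1)` in every coordinate. With `N = q ^ (d * (A + 1))` this gives at least
`N / q ^ d` pairs at normalized distance almost `φ(1)`, whereas a Poissonian pair correlation
function has no jump there.
-/

section PairCorrelations

variable {d : ℕ}

theorem torusSupNorm_eq_norm_coe (x : Fin d → ℝ) :
    torusSupNorm x = ‖fun j => (x j : UnitAddCircle)‖ := by
  simp only [torusSupNorm, Pi.norm_def]
  congr! 3 with j
  exact NNReal.eq UnitAddCircle.norm_eq.symm

theorem torusSupNorm_const [NeZero d] {c : ℝ} (hc : |c| ≤ 1 / 2) :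
    torusSupNorm (fun _ : Fin d => c) = |c| := by
  rw [torusSupNorm_eq_norm_coe, pi_norm_const, AddCircle.norm_coe_eq_abs_iff 1 one_ne_zero, abs_one]
  exact hc

theorem abs_torusSupNorm_sub_torusSupNorm_le (x y : Fin d → ℝ) :
    |torusSupNorm x - torusSupNorm y| ≤ ‖x - y‖ := by
  rw [torusSupNorm_eq_norm_coe, torusSupNorm_eq_norm_coe]
  refine (abs_norm_sub_norm_le _ _).trans ?_
  refine (pi_norm_le_iff_of_nonneg (norm_nonneg _)).2 fun j => ?_
  exact QuotientAddGroup.norm_mk_le_norm.trans (norm_le_pi_norm (x - y) j)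

theorem pairCount_add_ncard_le {x : ℕ → Fin d → ℝ} {s₁ s₂ : ℝ} {N : ℕ} (hs : s₁ ≤ s₂)
    {S : Set (ℕ × ℕ)} (hS : ∀ p ∈ S, p.1 < N ∧ p.2 < N ∧ p.1 ≠ p.2)
    (hdist : ∀ p ∈ S, torusSupNorm (x p.1 - x p.2) ∈
      Set.Ioc (s₁ / (N : ℝ) ^ (1 / (d : ℝ))) (s₂ / (N : ℝ) ^ (1 / (d : ℝ)))) :
    pairCount x s₁ N + S.ncard ≤ pairCount x s₂ N := by
  have hfin : (Set.Iio N ×ˢ Set.Iio N).Finite := (Set.finite_Iio N).prod (Set.finite_Iio N)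
  have hdisj : Disjoint {p : ℕ × ℕ | p.1 < N ∧ p.2 < N ∧ p.1 ≠ p.2 ∧
      torusSupNorm (x p.1 - x p.2) ≤ s₁ / (N : ℝ) ^ (1 / (d : ℝ))} S :=
    Set.disjoint_left.2 fun p hp hpS => (hdist p hpS).1.not_ge hp.2.2.2
  unfold pairCount
  rw [← Set.ncard_union_eq hdisj (hfin.subset fun p hp => ⟨hp.1, hp.2.1⟩)
    (hfin.subset fun p hp => ⟨(hS p hp).1, (hS p hp).2.1⟩)]
  refine Set.ncard_le_ncard ?_ (hfin.subset fun p hp => ⟨hp.1, hp.2.1⟩)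
  rintro p (⟨h₁, h₂, hne, hle⟩ | hp)
  · exact ⟨h₁, h₂, hne, hle.trans (by gcongr)⟩
  · exact ⟨(hS p hp).1, (hS p hp).2.1, (hS p hp).2.2, (hdist p hp).2⟩

theorem HasPoissonianPairCorrelations.exists_eventually_sub_lt {x : ℕ → Fin d → ℝ}
    (hx : HasPoissonianPairCorrelations x) {s c : ℝ} (hs : 0 < s) (hc : 0 < c) :
    ∃ ε > 0, ∀ᶠ N : ℕ in Filter.atTop,
      (pairCount x (s + ε) N : ℝ) / N - (pairCount x (s - ε) N : ℝ) / N < c := by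
  have hcont : Continuous fun ε : ℝ => (2 * (s + ε)) ^ d - (2 * (s - ε)) ^ d := by fun_prop
  have hjump : ∀ᶠ ε in nhds (0 : ℝ), (2 * (s + ε)) ^ d - (2 * (s - ε)) ^ d < c :=
    hcont.continuousAt.eventually_lt_const (by simpa using hc)
  obtain ⟨ε, ⟨hεc, hεs⟩, hε⟩ :=
    (((hjump.and (eventually_lt_nhds hs)).filter_mono nhdsWithin_le_nhds).and
      (self_mem_nhdsWithin (s := Set.Ioi 0))).exists
  have hε : 0 < ε := hε
  exact ⟨ε, hε, ((hx (s + ε) (by linarith)).sub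
    (hx (s - ε) (by linarith))).eventually_lt_const hεc⟩

theorem not_hasPoissonianPairCorrelations_of_frequently {x : ℕ → Fin d → ℝ} {s c : ℝ}
    (hs : 0 < s) (hc : 0 < c)
    (h : ∀ ε > 0, ∃ᶠ N : ℕ in Filter.atTop, ∃ S : Set (ℕ × ℕ), c * N ≤ S.ncard ∧
      (∀ p ∈ S, p.1 < N ∧ p.2 < N ∧ p.1 ≠ p.2) ∧
      ∀ p ∈ S, |(N : ℝ) ^ (1 / (d : ℝ)) * torusSupNorm (x p.1 - x p.2) - s| < ε) :
    ¬ HasPoissonianPairCorrelations x := by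
  intro hx
  obtain ⟨ε, hε, hlt⟩ := hx.exists_eventually_sub_lt hs hc
  obtain ⟨N, ⟨S, hcard, hS, hdist⟩, hlt, hN⟩ :=
    ((h ε hε).and_eventually (hlt.and (Filter.eventually_gt_atTop 0))).exists
  have hN : (0 : ℝ) < N := Nat.cast_pos.2 hN
  have hroot : 0 < (N : ℝ) ^ (1 / (d : ℝ)) := Real.rpow_pos_of_pos hN _
  have hcount : (pairCount x (s - ε) N : ℝ) + S.ncard ≤ pairCount x (s + ε) N := by
    refine mod_cast pairCount_add_ncard_le (by linarith) hS fun p hp => ?_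
    obtain ⟨hlower, hupper⟩ := abs_lt.1 (hdist p hp)
    exact ⟨(div_lt_iff₀' hroot).2 (by linarith), (le_div_iff₀' hroot).2 (by linarith)⟩
  rw [← sub_div, div_lt_iff₀ hN] at hlt
  linarith

end PairCorrelations

section Digits

theorem ofDigits_update {b : ℕ} (x : ℕ → Fin b) (m : ℕ) (a : Fin b) :
    Real.ofDigits (Function.update x m a) =
      Real.ofDigits x + (((a : ℕ) : ℝ) - (x m : ℕ)) / (b : ℝ) ^ (m + 1) := by
  have hterm : Real.ofDigitsTerm (Function.update x m a) =
      Function.update (Real.ofDigitsTerm x) m ((a : ℕ) * ((b : ℝ) ^ (m + 1))⁻¹) := by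
    ext i
    rcases eq_or_ne i m with rfl | him
    · simp [Real.ofDigitsTerm]
    · simp [Real.ofDigitsTerm, him]
  have hsum := Real.summable_ofDigitsTerm.hasSum (f := Real.ofDigitsTerm x).update m
    ((a : ℕ) * ((b : ℝ) ^ (m + 1))⁻¹)
  rw [Real.ofDigits, hterm, hsum.tsum_eq, Real.ofDigits, Real.ofDigitsTerm]
  ring

theorem abs_ofDigits_sub_ofDigits_sub_le {b : ℕ} {x y : ℕ → Fin b} {m n : ℕ}
    (hxy : ∀ i < n, i ≠ m → x i = y i) :
    |Real.ofDigits x - Real.ofDigits y - (((x m : ℕ) : ℝ) - (y m : ℕ)) / (b : ℝ) ^ (m + 1)| ≤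
      ((b : ℝ) ^ n)⁻¹ := by
  rw [sub_sub, ← ofDigits_update]
  refine Real.abs_ofDigits_sub_ofDigits_le fun i hi => ?_
  rcases eq_or_ne i m with rfl | him
  · rw [Function.update_self]
  · rw [Function.update_of_ne him, hxy i hi him]

end Digits

section RowFunctional

open Polynomial

variable {R : Type*} [CommSemiring R]

/-- The `i`-th coordinate of the image under `C` of the coefficient vector of a polynomial.
Identifying digit vectors with polynomials turns the two constructions into statements about
division by `Q`. -/
noncomputable def rowFunctional (C : Matrix ℕ ℕ R) (i : ℕ) : R[X] →ₗ[R] R :=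
  lsum fun k => LinearMap.mulLeft R (C i k)

theorem rowFunctional_apply (C : Matrix ℕ ℕ R) (i : ℕ) (P : R[X]) :
    rowFunctional C i P = P.sum fun k a => C i k * a :=
  rfl

theorem rowFunctional_eq {C : Matrix ℕ ℕ R} {i : ℕ} {ℓ : R[X] →ₗ[R] R}
    (h : ∀ k, ℓ (X ^ k) = C i k) : rowFunctional C i = ℓ := by
  ext k
  refine (sum_monomial_index 1 (fun k a => C i k * a) (mul_zero _)).trans ?_
  rw [mul_one, ← h, ← monomial_one_right_eq_X_pow, LinearMap.comp_apply]

end RowFunctional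

theorem card_le_card_ker_mul_card {R V W : Type*} [Ring R] [AddCommGroup V] [Module R V]
    [AddCommGroup W] [Module R W] [Finite W] (f : V →ₗ[R] W) :
    Nat.card V ≤ Nat.card (LinearMap.ker f) * Nat.card W := by
  rw [(LinearMap.ker f).card_eq_card_quotient_mul_card,
    Nat.card_congr f.quotKerEquivRange.toEquiv]
  exact Nat.mul_le_mul_left _ (Finite.card_subtype_le (· ∈ LinearMap.range f))

section DigitalSequences

open Polynomial

theorem coeff_eq_zero_of_mem_degreeLT {R : Type*} [Semiring R] {M : ℕ} {P : R[X]}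
    (hP : P ∈ degreeLT R M) {k : ℕ} (hk : M ≤ k) : P.coeff k = 0 :=
  (degree_lt_iff_coeff_zero P M).1 (mem_degreeLT.1 hP) k hk

variable {F : Type*} [Field F] [Fintype F] {φ : F ≃ Fin (Fintype.card F)} {d M : ℕ}
  {C : Fin d → Matrix ℕ ℕ F} {P D : F[X]}

/-- The integer in `[0, q ^ M)` whose base `q` digits are the images under `φ` of the first `M`
coefficients of `P`. -/
noncomputable def digitIndex (φ : F ≃ Fin (Fintype.card F)) (M : ℕ) (P : F[X]) : ℕ :=
  finFunctionFinEquiv fun k : Fin M => φ (P.coeff k)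

theorem digitIndex_lt (φ : F ≃ Fin (Fintype.card F)) (M : ℕ) (P : F[X]) :
    digitIndex φ M P < Fintype.card F ^ M :=
  (finFunctionFinEquiv _).isLt

theorem digitIndex_injOn (φ : F ≃ Fin (Fintype.card F)) (M : ℕ) :
    Set.InjOn (digitIndex φ M) (degreeLT F M) := by
  intro P hP D hD h
  ext k
  rcases lt_or_ge k M with hk | hk
  · exact φ.injective (congrFun (finFunctionFinEquiv.injective (Fin.ext h)) ⟨k, hk⟩)
  · rw [coeff_eq_zero_of_mem_degreeLT hP hk, coeff_eq_zero_of_mem_degreeLT hD hk]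

theorem baseDigit_digitIndex (hφ : (φ 0 : ℕ) = 0) (hP : P ∈ degreeLT F M) (k : ℕ) :
    baseDigit F (digitIndex φ M P) k = φ (P.coeff k) := by
  rcases lt_or_ge k M with hk | hk
  · exact congrFun (finFunctionFinEquiv.symm_apply_apply fun k : Fin M => φ (P.coeff k)) ⟨k, hk⟩
  · have hlt : digitIndex φ M P < Fintype.card F ^ k :=
      (digitIndex_lt φ M P).trans_le (Nat.pow_le_pow_right Fintype.card_pos hk)
    apply Fin.ext
    rw [coeff_eq_zero_of_mem_degreeLT hP hk, hφ, baseDigit, Fin.val_mk, Nat.div_eq_of_lt hlt,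
      Nat.zero_mod]

theorem digitalVector_digitIndex (hφ : (φ 0 : ℕ) = 0) (hP : P ∈ degreeLT F M)
    (C : Matrix ℕ ℕ F) (i : ℕ) :
    digitalVector φ C (digitIndex φ M P) i = rowFunctional C i P := by
  simp only [digitalVector, baseDigit_digitIndex hφ hP, Equiv.symm_apply_apply]
  refine finsum_eq_sum_of_support_subset _ fun k hk => ?_
  exact mem_support_iff.2 (right_ne_zero_of_mul hk)

theorem digitalSequence_eq_ofDigits (φ : F ≃ Fin (Fintype.card F)) (C : Fin d → Matrix ℕ ℕ F)
    (n : ℕ) (j : Fin d) :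
    digitalSequence φ C n j = Real.ofDigits fun i => φ (digitalVector φ (C j) n i) :=
  tsum_congr fun _ => div_eq_mul_inv _ _

theorem digit_one_pos (hφ : (φ 0 : ℕ) = 0) : 0 < (φ 1 : ℕ) :=
  Nat.pos_of_ne_zero fun h => one_ne_zero (φ.injective (Fin.ext (h.trans hφ.symm)))

theorem abs_digitalSequence_sub_sub_le (hφ : (φ 0 : ℕ) = 0) (hP : P ∈ degreeLT F M)
    (hD : D ∈ degreeLT F M) {j : Fin d} {A n : ℕ} (hA : A < n)
    (hProw : ∀ i < n, rowFunctional (C j) i P = if i = A then 1 else 0)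
    (hDrow : rowFunctional (C j) A D = 0) :
    |digitalSequence φ C (digitIndex φ M (P + D)) j - digitalSequence φ C (digitIndex φ M D) j -
      (φ 1 : ℕ) / (Fintype.card F : ℝ) ^ (A + 1)| ≤ ((Fintype.card F : ℝ) ^ n)⁻¹ := by
  have hdigits : ∀ i < n, i ≠ A →
      φ (rowFunctional (C j) i (P + D)) = φ (rowFunctional (C j) i D) := fun i hi hiA => by
    rw [map_add, hProw i hi, if_neg hiA, zero_add]
  have h := abs_ofDigits_sub_ofDigits_sub_le hdigits
  rw [map_add, hProw A hA, if_pos rfl, hDrow, add_zero, hφ, Nat.cast_zero, sub_zero] at h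
  simpa only [digitalSequence_eq_ofDigits, digitalVector_digitIndex hφ hD,
    digitalVector_digitIndex hφ (add_mem hP hD)] using h

theorem abs_torusSupNorm_digitalSequence_sub_le [NeZero d] (hφ : (φ 0 : ℕ) = 0)
    (hP : P ∈ degreeLT F M) (hD : D ∈ degreeLT F M) {A n : ℕ} (hA : 0 < A) (hAn : A < n)
    (hProw : ∀ j, ∀ i < n, rowFunctional (C j) i P = if i = A then 1 else 0)
    (hDrow : ∀ j, rowFunctional (C j) A D = 0) :
    |torusSupNorm (digitalSequence φ C (digitIndex φ M (P + D)) -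
        digitalSequence φ C (digitIndex φ M D)) - (φ 1 : ℕ) / (Fintype.card F : ℝ) ^ (A + 1)| ≤
      ((Fintype.card F : ℝ) ^ n)⁻¹ := by
  set c : ℝ := (φ 1 : ℕ) / (Fintype.card F : ℝ) ^ (A + 1)
  have hq : (2 : ℝ) ≤ Fintype.card F := mod_cast Fintype.one_lt_card (α := F)
  have hc₀ : 0 ≤ c := by positivity
  have hc : c ≤ 1 / 2 :=
    calc c ≤ Fintype.card F / (Fintype.card F : ℝ) ^ (A + 1) :=
          div_le_div_of_nonneg_right (mod_cast (φ 1).isLt.le) (by positivity)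
      _ = ((Fintype.card F : ℝ) ^ A)⁻¹ := by
          rw [pow_succ]
          field_simp
      _ ≤ 1 / 2 := by
          rw [one_div]
          exact inv_anti₀ two_pos (hq.trans (le_self_pow₀ (by linarith) hA.ne'))
  have hconst : torusSupNorm (fun _ : Fin d => c) = c := by
    rw [torusSupNorm_const (by rwa [abs_of_nonneg hc₀]), abs_of_nonneg hc₀]
  rw [← hconst]
  refine (abs_torusSupNorm_sub_torusSupNorm_le _ _).trans ?_
  refine (pi_norm_le_iff_of_nonneg (by positivity)).2 fun j => ?_
  exact abs_digitalSequence_sub_sub_le hφ hP hD hAn (hProw j) (hDrow j)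

theorem abs_pow_mul_torusSupNorm_digitalSequence_sub_le [NeZero d] (hφ : (φ 0 : ℕ) = 0)
    (hP : P ∈ degreeLT F M) (hD : D ∈ degreeLT F M) {A T : ℕ} (hA : 0 < A) (hT : 0 < T)
    (hProw : ∀ j, ∀ i < A + T, rowFunctional (C j) i P = if i = A then 1 else 0)
    (hDrow : ∀ j, rowFunctional (C j) A D = 0) :
    |(Fintype.card F : ℝ) ^ (A + 1) * torusSupNorm (digitalSequence φ C (digitIndex φ M (P + D)) -
        digitalSequence φ C (digitIndex φ M D)) - (φ 1 : ℕ)| ≤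
      Fintype.card F / (Fintype.card F : ℝ) ^ T := by
  have hdist := abs_torusSupNorm_digitalSequence_sub_le hφ hP hD hA
    (Nat.lt_add_of_pos_right hT) hProw hDrow
  have hqA : (0 : ℝ) < (Fintype.card F : ℝ) ^ (A + 1) := by positivity
  calc |(Fintype.card F : ℝ) ^ (A + 1) * torusSupNorm _ - (φ 1 : ℕ)|
      = (Fintype.card F : ℝ) ^ (A + 1) *
          |torusSupNorm _ - (φ 1 : ℕ) / (Fintype.card F : ℝ) ^ (A + 1)| := by
        rw [← abs_of_pos hqA, ← abs_mul, mul_sub, abs_of_pos hqA, mul_div_cancel₀ _ hqA.ne']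
    _ ≤ (Fintype.card F : ℝ) ^ (A + 1) * ((Fintype.card F : ℝ) ^ (A + T))⁻¹ := by gcongr
    _ = Fintype.card F / (Fintype.card F : ℝ) ^ T := by
        rw [pow_add _ A T, pow_succ]
        field_simp

theorem exists_ncard_digitIndex_pairs (φ : F ≃ Fin (Fintype.card F)) (hP : P ∈ degreeLT F M)
    (hP₀ : P ≠ 0) (ℓ : Fin d → F[X] →ₗ[F] F) :
    ∃ S : Set (ℕ × ℕ), Fintype.card F ^ M ≤ S.ncard * Fintype.card F ^ d ∧
      (∀ p ∈ S, p.1 < Fintype.card F ^ M ∧ p.2 < Fintype.card F ^ M ∧ p.1 ≠ p.2) ∧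
      ∀ p ∈ S, ∃ D ∈ degreeLT F M, (∀ j, ℓ j D = 0) ∧
        p = (digitIndex φ M (P + D), digitIndex φ M D) := by
  let f : degreeLT F M →ₗ[F] Fin d → F := LinearMap.pi ℓ ∘ₗ (degreeLT F M).subtype
  let pair : LinearMap.ker f → ℕ × ℕ := fun D => (digitIndex φ M (P + D), digitIndex φ M D)
  have hpair : Function.Injective pair := fun D E h =>
    Subtype.ext (Subtype.ext (digitIndex_injOn φ M D.1.2 E.1.2 (Prod.ext_iff.1 h).2))
  refine ⟨Set.range pair, ?_, ?_, ?_⟩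
  · have hcard := card_le_card_ker_mul_card f
    rw [Nat.card_congr (degreeLTEquiv F M).toEquiv] at hcard
    rw [Set.ncard_range_of_injective hpair]
    simpa using hcard
  · rintro _ ⟨D, rfl⟩
    refine ⟨digitIndex_lt φ M _, digitIndex_lt φ M _, fun h => hP₀ ?_⟩
    exact add_eq_right.1 (digitIndex_injOn φ M (add_mem hP D.1.2) D.1.2 h)
  · rintro _ ⟨D, rfl⟩
    exact ⟨D, D.1.2, congrFun (LinearMap.mem_ker.1 D.2), rfl⟩

theorem not_hasPoissonianPairCorrelations_digitalSequence [NeZero d] (hφ : (φ 0 : ℕ) = 0)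
    (h : ∀ T, ∃ A ≥ T, ∃ P ∈ degreeLT F (d * (A + 1)),
      ∀ j, ∀ i < A + T, rowFunctional (C j) i P = if i = A then 1 else 0) :
    ¬ HasPoissonianPairCorrelations (digitalSequence φ C) := by
  have hq₁ : 1 < Fintype.card F := Fintype.one_lt_card
  have hq₁' : (1 : ℝ) < Fintype.card F := mod_cast hq₁
  refine not_hasPoissonianPairCorrelations_of_frequently (s := (φ 1 : ℕ))
    (c := ((Fintype.card F : ℝ) ^ d)⁻¹) (mod_cast digit_one_pos hφ) (by positivity)
    fun ε hε => Filter.frequently_atTop.2 fun a => ?_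
  have hlim : Filter.Tendsto (fun T : ℕ => (Fintype.card F : ℝ) / (Fintype.card F : ℝ) ^ T)
      Filter.atTop (nhds 0) :=
    (tendsto_pow_atTop_atTop_of_one_lt hq₁').const_div_atTop _
  obtain ⟨T, hTε, hT⟩ := ((hlim.eventually_lt_const hε).and
    (Filter.eventually_ge_atTop (max 1 a))).exists
  obtain ⟨A, hTA, P, hP, hrow⟩ := h T
  have hT₁ : 0 < T := le_of_max_le_left hT
  have hP₀ : P ≠ 0 := by
    rintro rfl
    simpa using hrow 0 A (by omega)
  obtain ⟨S, hcard, hS, hSD⟩ :=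
    exists_ncard_digitIndex_pairs φ hP hP₀ fun j => rowFunctional (C j) A
  have ha : a ≤ Fintype.card F ^ (d * (A + 1)) :=
    calc a ≤ A + 1 := (le_of_max_le_right hT).trans (hTA.trans A.le_succ)
      _ ≤ d * (A + 1) := Nat.le_mul_of_pos_left _ (NeZero.pos d)
      _ ≤ Fintype.card F ^ (d * (A + 1)) := (Nat.lt_pow_self hq₁).le
  have hroot : ((Fintype.card F ^ (d * (A + 1)) : ℕ) : ℝ) ^ (1 / (d : ℝ)) =
      (Fintype.card F : ℝ) ^ (A + 1) := by
    rw [Nat.cast_pow, mul_comm, pow_mul, one_div,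
      Real.pow_rpow_inv_natCast (by positivity) (NeZero.ne d)]
  refine ⟨Fintype.card F ^ (d * (A + 1)), ha, S, ?_, hS, fun p hp => ?_⟩
  · rw [inv_mul_le_iff₀' (by positivity)]
    exact_mod_cast hcard
  obtain ⟨D, hD, hDrow, rfl⟩ := hSD p hp
  rw [hroot]
  exact (abs_pow_mul_torusSupNorm_digitalSequence_sub_le hφ hP hD (hT₁.trans_le hTA) hT₁ hrow
    hDrow).trans_lt hTε

end DigitalSequences

section AdicMatrices

open Polynomial

variable {R : Type*} [CommSemiring R] {Q : R[X]} {C : Matrix ℕ ℕ R}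

/-- The property shared by the two constructions, stated on coefficient vectors of polynomials:
the matrix sends `1` to the first unit vector and turns multiplication by `Q` into the shift by
`deg Q` rows, with zeros entering from above. -/
structure IsAdicMatrix (Q : R[X]) (C : Matrix ℕ ℕ R) : Prop where
  rowFunctional_one (i : ℕ) : rowFunctional C i 1 = if i = 0 then 1 else 0
  rowFunctional_mul_of_lt {i : ℕ} (hi : i < Q.natDegree) (P : R[X]) :
    rowFunctional C i (Q * P) = 0
  rowFunctional_mul (i : ℕ) (P : R[X]) :
    rowFunctional C (Q.natDegree + i) (Q * P) = rowFunctional C i P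

theorem IsAdicMatrix.rowFunctional_pow_mul (h : IsAdicMatrix Q C) (n i : ℕ) (P : R[X]) :
    rowFunctional C (Q.natDegree * n + i) (Q ^ n * P) = rowFunctional C i P := by
  induction n with
  | zero => rw [mul_zero, zero_add, pow_zero, one_mul]
  | succ n ih => rw [mul_add_one, add_right_comm, add_comm, pow_succ', mul_assoc,
      h.rowFunctional_mul, ih]

theorem IsAdicMatrix.rowFunctional_pow_mul_of_lt (h : IsAdicMatrix Q C) {n i : ℕ}
    (hi : i < Q.natDegree * n) (P : R[X]) : rowFunctional C i (Q ^ n * P) = 0 := by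
  induction n generalizing i with
  | zero => exact absurd hi (by simp)
  | succ n ih =>
    rw [pow_succ', mul_assoc]
    rcases lt_or_ge i Q.natDegree with hlt | hge
    · exact h.rowFunctional_mul_of_lt hlt _
    · obtain ⟨i, rfl⟩ := Nat.exists_eq_add_of_le hge
      rw [h.rowFunctional_mul, ih (by lia)]

theorem IsAdicMatrix.rowFunctional_pow_mul_one_add (h : IsAdicMatrix Q C) {S T i : ℕ}
    (hi : i < Q.natDegree * (S + T)) (w : R[X]) :
    rowFunctional C i (Q ^ S * (1 + Q ^ T * w)) = if i = Q.natDegree * S then 1 else 0 := by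
  rcases lt_or_ge i (Q.natDegree * S) with hlt | hge
  · rw [h.rowFunctional_pow_mul_of_lt hlt, if_neg hlt.ne]
  · obtain ⟨i, rfl⟩ := Nat.exists_eq_add_of_le hge
    rw [h.rowFunctional_pow_mul, map_add, h.rowFunctional_one,
      h.rowFunctional_pow_mul_of_lt (by lia), add_zero]
    simp only [Nat.add_eq_left]

end AdicMatrices

section NiederreiterMatrix

open Polynomial

variable {F : Type*} [Field F]

theorem polyAtInfinity_C (c : F) : polyAtInfinity (C c) = HahnSeries.C c := by
  rw [polyAtInfinity, aeval_C, HahnSeries.algebraMap_apply', ← HahnSeries.ofPowerSeries_C]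
  rfl

theorem polyAtInfinity_monomial (k : ℕ) (c : F) :
    polyAtInfinity (monomial k c) = HahnSeries.single (-(k : ℤ)) c := by
  rw [← C_mul_X_pow_eq_monomial, map_mul, polyAtInfinity_C, map_pow, polyAtInfinity, aeval_X,
    HahnSeries.single_pow, HahnSeries.C_apply, HahnSeries.single_mul_single, zero_add, one_pow,
    mul_one, nsmul_eq_mul, mul_neg_one]

theorem coeff_polyAtInfinity (f : F[X]) (n : ℕ) :
    (polyAtInfinity f).coeff (-(n : ℤ)) = f.coeff n := by
  induction f using Polynomial.induction_on' with
  | add f g hf hg => rw [map_add, HahnSeries.coeff_add, hf, hg, coeff_add]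
  | monomial k a =>
    simp only [polyAtInfinity_monomial, HahnSeries.coeff_single, coeff_monomial, neg_inj,
      Nat.cast_inj, eq_comm]

theorem coeff_polyAtInfinity_of_pos (f : F[X]) {z : ℤ} (hz : 0 < z) :
    (polyAtInfinity f).coeff z = 0 := by
  induction f using Polynomial.induction_on' with
  | add f g hf hg => rw [map_add, HahnSeries.coeff_add, hf, hg, add_zero]
  | monomial k a => rw [polyAtInfinity_monomial, HahnSeries.coeff_single_of_ne (by lia)]

theorem polyAtInfinity_ne_zero {f : F[X]} (hf : f ≠ 0) : polyAtInfinity f ≠ 0 := fun h => by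
  have hlead := coeff_polyAtInfinity f f.natDegree
  rw [h, HahnSeries.coeff_zero] at hlead
  exact hf (leadingCoeff_eq_zero.1 hlead.symm)

theorem order_polyAtInfinity {f : F[X]} (hf : f ≠ 0) :
    (polyAtInfinity f).order = -(f.natDegree : ℤ) := by
  have hne := mt HahnSeries.coeff_order_eq_zero.1 (polyAtInfinity_ne_zero hf)
  obtain ⟨n, hn⟩ : ∃ n : ℕ, -(polyAtInfinity f).order = n :=
    Int.eq_ofNat_of_zero_le <| neg_nonneg.2 <| not_lt.1 fun hpos =>
      hne (coeff_polyAtInfinity_of_pos f hpos)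
  rw [← neg_neg (polyAtInfinity f).order, hn, coeff_polyAtInfinity] at hne
  refine le_antisymm (HahnSeries.order_le_of_coeff_ne_zero ?_) ?_
  · rw [coeff_polyAtInfinity]
    exact leadingCoeff_ne_zero.2 hf
  · have hle := le_natDegree_of_ne_zero hne
    lia

theorem leadingCoeff_polyAtInfinity (f : F[X]) :
    (polyAtInfinity f).leadingCoeff = f.leadingCoeff := by
  rcases eq_or_ne f 0 with rfl | hf
  · rw [map_zero, HahnSeries.leadingCoeff_zero, leadingCoeff_zero]
  · rw [HahnSeries.leadingCoeff_eq, order_polyAtInfinity hf, coeff_polyAtInfinity, leadingCoeff]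

theorem coeff_one_polyAtInfinity_div {f g : F[X]} (hf : f.Monic) (hg : g.Monic)
    (h : f.natDegree < g.natDegree) :
    (polyAtInfinity f / polyAtInfinity g).coeff 1 =
      if g.natDegree = f.natDegree + 1 then 1 else 0 := by
  have hf₀ := polyAtInfinity_ne_zero hf.ne_zero
  have hg₀ := polyAtInfinity_ne_zero hg.ne_zero
  set y := polyAtInfinity f / polyAtInfinity g
  have hy₀ : y ≠ 0 := div_ne_zero hf₀ hg₀
  have hmul : y * polyAtInfinity g = polyAtInfinity f := div_mul_cancel₀ _ hg₀
  have horder : y.order = (g.natDegree : ℤ) - f.natDegree := by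
    have := HahnSeries.order_mul hy₀ hg₀
    rw [hmul, order_polyAtInfinity hf.ne_zero, order_polyAtInfinity hg.ne_zero] at this
    lia
  have hlead : y.leadingCoeff = 1 := by
    have := HahnSeries.leadingCoeff_mul y (polyAtInfinity g)
    rwa [hmul, leadingCoeff_polyAtInfinity, leadingCoeff_polyAtInfinity, hf.leadingCoeff,
      hg.leadingCoeff, mul_one, eq_comm] at this
  split_ifs with hdeg
  · rw [← hlead, HahnSeries.leadingCoeff_eq, horder, hdeg, Nat.cast_succ, add_sub_cancel_left]
  · exact HahnSeries.coeff_eq_zero_of_lt_order (by lia)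

theorem rowFunctional_niederreiterMatrix (Q P : F[X]) (i : ℕ) :
    rowFunctional (niederreiterMatrix Q) i P =
      (polyAtInfinity (P * X ^ (Q.natDegree - 1 - i % Q.natDegree)) /
        polyAtInfinity (Q ^ (i / Q.natDegree + 1))).coeff 1 := by
  set g := polyAtInfinity (X ^ (Q.natDegree - 1 - i % Q.natDegree)) /
    polyAtInfinity (Q ^ (i / Q.natDegree + 1))
  let ℓ : F[X] →ₗ[F] F :=
    { toFun := fun f => (polyAtInfinity f * g).coeff 1
      map_add' := fun f h => by rw [map_add, add_mul, HahnSeries.coeff_add]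
      map_smul' := fun c f => by
        rw [smul_eq_C_mul, map_mul, polyAtInfinity_C, mul_assoc, HahnSeries.C_mul_eq_smul,
          HahnSeries.coeff_smul, RingHom.id_apply] }
  have hℓ (k : ℕ) : ℓ (X ^ k) = niederreiterMatrix Q i k := by
    change (polyAtInfinity (X ^ k) * g).coeff 1 = g.coeff ((k : ℤ) + 1)
    rw [← monomial_one_right_eq_X_pow, polyAtInfinity_monomial, HahnSeries.coeff_single_mul,
      one_mul, sub_neg_eq_add, add_comm]
  rw [rowFunctional_eq hℓ, map_mul, mul_div_assoc]
  rfl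

theorem isAdicMatrix_niederreiterMatrix {Q : F[X]} (hQ : Q.Monic) (hdeg : 0 < Q.natDegree) :
    IsAdicMatrix Q (niederreiterMatrix Q) where
  rowFunctional_one i := by
    have hmod := Nat.mod_lt i hdeg
    have hdiv := Nat.div_add_mod i Q.natDegree
    have : Q.natDegree ≤ Q.natDegree * (i / Q.natDegree + 1) :=
      Nat.le_mul_of_pos_right _ (Nat.succ_pos _)
    have hpow : (Q ^ (i / Q.natDegree + 1)).natDegree = Q.natDegree * (i / Q.natDegree + 1) := by
      rw [hQ.natDegree_pow, mul_comm]
    rw [rowFunctional_niederreiterMatrix, one_mul,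
      coeff_one_polyAtInfinity_div (monic_X_pow _) (hQ.pow _) (by rw [hpow, natDegree_X_pow]; lia),
      hpow, natDegree_X_pow]
    congr 1
    rw [mul_add_one, eq_iff_iff]
    lia
  rowFunctional_mul_of_lt {i} hi P := by
    rw [rowFunctional_niederreiterMatrix, Nat.div_eq_of_lt hi, zero_add, pow_one, mul_assoc,
      map_mul, mul_div_cancel_left₀ _ (polyAtInfinity_ne_zero hQ.ne_zero),
      coeff_polyAtInfinity_of_pos _ one_pos]
  rowFunctional_mul i P := by
    rw [rowFunctional_niederreiterMatrix, rowFunctional_niederreiterMatrix, Nat.add_mod_left,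
      Nat.add_div_left _ hdeg, mul_assoc, pow_succ' Q (_ + 1), map_mul, map_mul _ Q,
      mul_div_mul_left _ _ (polyAtInfinity_ne_zero hQ.ne_zero)]

end NiederreiterMatrix

section ColumnMatrix

open Polynomial

variable {F : Type*} [Field F]

/-- The quotient by a monic polynomial as a linear map, the counterpart of
`Polynomial.modByMonicHom`. -/
noncomputable def divByMonicHom {R : Type*} [CommRing R] {Q : R[X]} (hQ : Q.Monic) :
    R[X] →ₗ[R] R[X] where
  toFun f := f /ₘ Q
  map_add' f g := by
    nontriviality R
    refine (div_modByMonic_unique (f /ₘ Q + g /ₘ Q) ((f + g) %ₘ Q) hQ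
      ⟨?_, degree_modByMonic_lt _ hQ⟩).1
    rw [add_modByMonic]
    linear_combination modByMonic_add_div f Q + modByMonic_add_div g Q
  map_smul' c f := by
    nontriviality R
    refine (div_modByMonic_unique (c • (f /ₘ Q)) ((c • f) %ₘ Q) hQ
      ⟨?_, degree_modByMonic_lt _ hQ⟩).1
    rw [smul_modByMonic, mul_smul_comm, ← smul_add, modByMonic_add_div]

theorem rowFunctional_columnMatrix {Q : F[X]} (hQ : Q.Monic) (P : F[X]) (i : ℕ) :
    rowFunctional (columnMatrix Q) i P =
      (adicDigit Q P (i / Q.natDegree)).coeff (i % Q.natDegree) := by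
  let ℓ : F[X] →ₗ[F] F := lcoeff F (i % Q.natDegree) ∘ₗ modByMonicHom Q ∘ₗ
    divByMonicHom hQ ^ (i / Q.natDegree)
  have hℓ (f : F[X]) : ℓ f = (adicDigit Q f (i / Q.natDegree)).coeff (i % Q.natDegree) := by
    simp only [ℓ, LinearMap.comp_apply, Module.End.pow_apply]
    rfl
  rw [rowFunctional_eq fun k => hℓ (X ^ k), hℓ]

theorem isAdicMatrix_columnMatrix {Q : F[X]} (hQ : Q.Monic) (hdeg : 0 < Q.natDegree) :
    IsAdicMatrix Q (columnMatrix Q) where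
  rowFunctional_one i := by
    have hone : (1 : F[X]).degree < Q.degree := by
      rw [degree_one]
      exact natDegree_pos_iff_degree_pos.1 hdeg
    rw [rowFunctional_columnMatrix hQ]
    rcases lt_or_ge i Q.natDegree with hlt | hge
    · rw [Nat.div_eq_of_lt hlt, Nat.mod_eq_of_lt hlt, adicDigit, Function.iterate_zero_apply,
        (modByMonic_eq_self_iff hQ).2 hone, coeff_one]
    · obtain ⟨i, rfl⟩ := Nat.exists_eq_add_of_le hge
      rw [Nat.add_mod_left, Nat.add_div_left _ hdeg, adicDigit, Function.iterate_succ_apply,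
        (divByMonic_eq_zero_iff hQ).2 hone, ← adicDigit, ← rowFunctional_columnMatrix hQ, map_zero,
        if_neg (by lia)]
  rowFunctional_mul_of_lt {i} hi P := by
    rw [rowFunctional_columnMatrix hQ, Nat.div_eq_of_lt hi, adicDigit, Function.iterate_zero_apply,
      (modByMonic_eq_zero_iff_dvd hQ).2 (dvd_mul_right Q P), coeff_zero]
  rowFunctional_mul i P := by
    rw [rowFunctional_columnMatrix hQ, rowFunctional_columnMatrix hQ, Nat.add_mod_left,
      Nat.add_div_left _ hdeg, adicDigit, Function.iterate_succ_apply,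
      mul_divByMonic_cancel_left _ hQ, adicDigit]

end ColumnMatrix

section CommonPolynomial

open Polynomial

theorem hasFiniteQuotients_polynomial (F : Type*) [Field F] [Finite F] :
    Ring.HasFiniteQuotients F[X] where
  finiteQuotient {I} hI := by
    obtain ⟨V, rfl⟩ := IsPrincipalIdealRing.principal I
    rw [Ideal.submodule_span_eq] at hI ⊢
    have hV : V ≠ 0 := fun h => hI (Ideal.span_singleton_eq_bot.2 h)
    have : Module.Finite F (F[X] ⧸ Ideal.span {V}) := (AdjoinRoot.powerBasis hV).finite
    exact Module.finite_of_finite F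

theorem exists_dvd_pow_sub_one {R : Type*} [CommRing R] [Ring.HasFiniteQuotients R] {u v : R}
    (hv : v ≠ 0) (h : IsCoprime u v) : ∃ n : ℕ, 0 < n ∧ v ∣ u ^ n - 1 := by
  have : Finite (R ⧸ Ideal.span {v}) :=
    Ring.HasFiniteQuotients.finiteQuotient (mt Ideal.span_singleton_eq_bot.1 hv)
  have hu : IsUnit (Ideal.Quotient.mk (Ideal.span {v}) u) := by
    have hmap := h.map (Ideal.Quotient.mk (Ideal.span {v}))
    rwa [Ideal.Quotient.mk_singleton_self, isCoprime_zero_right] at hmap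
  obtain ⟨n, hn, hpow⟩ := isOfFinOrder_iff_pow_eq_one.1 hu.isOfFinOrder
  refine ⟨n, hn, Ideal.mem_span_singleton.1 (Ideal.Quotient.eq.1 ?_)⟩
  rw [map_pow, hpow, map_one]

theorem exists_natDegree_eq_and_forall_eq_pow_mul_one_add {F ι : Type*} [Field F] [Finite F]
    [Fintype ι] {Q : ι → F[X]} (hdeg : ∀ j, 0 < (Q j).natDegree)
    (hcoprime : Pairwise (Function.onFun IsCoprime Q)) (T : ℕ) :
    ∃ A ≥ T, ∃ P : F[X], P.natDegree = Fintype.card ι * A ∧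
      ∀ j, ∃ (S : ℕ) (w : F[X]), (Q j).natDegree * S = A ∧ P = Q j ^ S * (1 + Q j ^ T * w) := by
  classical
  have := hasFiniteQuotients_polynomial F
  have hQ (j : ι) : Q j ≠ 0 := ne_zero_of_natDegree_gt (hdeg j)
  let a : ι → ℕ := fun k => ∏ i ∈ Finset.univ.erase k, (Q i).natDegree
  have ha (k : ι) : (Q k).natDegree * a k = ∏ i, (Q i).natDegree :=
    Finset.mul_prod_erase _ (fun i => (Q i).natDegree) (Finset.mem_univ k)
  let U : ι → F[X] := fun j => ∏ k ∈ Finset.univ.erase j, Q k ^ a k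
  have hU (j : ι) : ∃ n : ℕ, 0 < n ∧ Q j ^ T ∣ U j ^ n - 1 := by
    refine exists_dvd_pow_sub_one (pow_ne_zero T (hQ j)) (IsCoprime.prod_left fun k hk => ?_)
    exact (hcoprime (Finset.ne_of_mem_erase hk)).pow
  choose n hn hdvd using hU
  let N : ℕ := T * ∏ j, n j
  have hN : T ≤ N := Nat.le_mul_of_pos_right _ (Finset.prod_pos fun j _ => hn j)
  refine ⟨(∏ i, (Q i).natDegree) * N, ?_, (∏ k, Q k ^ a k) ^ N, ?_, fun j => ?_⟩
  · exact hN.trans (Nat.le_mul_of_pos_left _ (Finset.prod_pos fun j _ => hdeg j))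
  · rw [natDegree_pow, natDegree_prod _ _ fun k _ => pow_ne_zero _ (hQ k)]
    simp only [natDegree_pow, fun k => mul_comm (a k), ha, Finset.sum_const, Finset.card_univ,
      smul_eq_mul]
    ring
  · obtain ⟨c, hc⟩ : n j ∣ N := (Finset.dvd_prod_of_mem n (Finset.mem_univ j)).mul_left T
    obtain ⟨w, hw⟩ := (hdvd j).trans (sub_one_dvd_pow_sub_one (U j ^ n j) c)
    have hprod : Q j ^ a j * U j = ∏ k, Q k ^ a k :=
      Finset.mul_prod_erase _ (fun k => Q k ^ a k) (Finset.mem_univ j)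
    refine ⟨a j * N, w, by rw [← mul_assoc, ha], ?_⟩
    rw [← hw, ← pow_mul, ← hc, add_sub_cancel, ← hprod, mul_pow, pow_mul (Q j) (a j) N]

end CommonPolynomial

theorem theorem1_general {F : Type*} [Field F] [Fintype F]
    (φ : F ≃ Fin (Fintype.card F)) (hφ : (φ 0 : ℕ) = 0)
    {d : ℕ} (hd : 1 ≤ d)
    (Q : Fin d → Polynomial F)
    (hnonconst : ∀ j, 0 < (Q j).natDegree)
    (hcoprime : ∀ i j, i ≠ j → IsCoprime (Q i) (Q j))
    (C : Fin d → Matrix ℕ ℕ F)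
    (hC : ∀ j, IsAdicMatrix (Q j) (C j)) :
    ¬ HasPoissonianPairCorrelations (digitalSequence φ C) := by
  have : NeZero d := ⟨by lia⟩
  refine not_hasPoissonianPairCorrelations_digitalSequence hφ fun T => ?_
  obtain ⟨A, hTA, P, hP, hPQ⟩ :=
    exists_natDegree_eq_and_forall_eq_pow_mul_one_add hnonconst (fun i j => hcoprime i j) T
  rw [Fintype.card_fin] at hP
  refine ⟨A, hTA, P, ?_, fun j i hi => ?_⟩
  · refine Polynomial.mem_degreeLT.2 (Polynomial.degree_le_natDegree.trans_lt ?_)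
    rw [hP]
    exact_mod_cast Nat.mul_lt_mul_of_pos_left A.lt_succ_self hd
  obtain ⟨S, w, rfl, hPS⟩ := hPQ j
  rw [hPS]
  refine (hC j).rowFunctional_pow_mul_one_add ?_ w
  rw [mul_add]
  exact hi.trans_le (Nat.add_le_add_left (Nat.le_mul_of_pos_left _ (hnonconst j)) _)

theorem theorem1 {F : Type*} [Field F] [Fintype F]
    (φ : F ≃ Fin (Fintype.card F)) (hφ : (φ 0 : ℕ) = 0)
    {d : ℕ} (hd : 1 ≤ d)
    (Q : Fin d → Polynomial F)
    (hmonic : ∀ j, (Q j).Monic)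
    (hnonconst : ∀ j, 0 < (Q j).natDegree)
    (hcoprime : ∀ i j, i ≠ j → IsCoprime (Q i) (Q j))
    (C : Fin d → Matrix ℕ ℕ F)
    (hC : ∀ j, C j = niederreiterMatrix (Q j) ∨ C j = columnMatrix (Q j)) :
    ¬ HasPoissonianPairCorrelations (digitalSequence φ C) := by
  refine theorem1_general φ hφ hd Q hnonconst hcoprime C fun j => ?_
  rcases hC j with h | h <;> rw [h]
  exacts [isAdicMatrix_niederreiterMatrix (hmonic j) (hnonconst j),
    isAdicMatrix_columnMatrix (hmonic j) (hnonconst j)]
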